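/- \textbf{Theorem (Decomposition of a c.n.u. $\mathbb{A}_r$-contraction).} Let $0<r<1$, let $\overline{\mathbb{A}}_r=\{z\in\mathbb{C}: r\le |z|\le 1\}$, and let all operators be bounded linear operators on complex Hilbert spaces. A closed subspace $\mathcal{L}$ \emph{reduces} an operator $T$ if it is invariant under both $T$ and $T^*$. An operator $T$ is called \begin{itemize} \item an \emph{$\mathbb{A}_r$-contraction} if $\sigma(T)\subseteq\overline{\mathbb{A}}_r$ and $\|f(T)\|\le\sup_{z\in\overline{\mathbb{A}}_r}|f(z)|$ for every rational function $f=p/q$, where $p,q\in\mathbb{C}[z]$ and $q$ has no zeros in $\overline{\mathbb{A}}_r$; \item an \emph{$\mathbb{A}_r$-unitary} if $T$ is normal and $\sigma(T)\subseteq\partial\mathbb{A}_r=\{z\in\mathbb{C}: |z|=r \text{ or } |z|=1\}$; \item an \emph{$\mathbb{A}_r$-isometry} if $\sigma(T)\subseteq\overline{\mathbb{A}}_r$ and $T$ is the restriction to an invariant subspace of an $\mathbb{A}_r$-unitary acting on a Hilbert space containing the space of $T$; \item a \emph{pure $\mathbb{A}_r$-isometry} if $T$ is an $\mathbb{A}_r$-isometry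 and no non-zero closed subspace reduces $T$ to an $\mathbb{A}_r$-unitary; \item a \emph{c.n.u. (completely non-unitary) $\mathbb{A}_r$-contraction} if $T$ is an $\mathbb{A}_r$-contraction and no non-zero closed subspace reduces $T$ to an $\mathbb{A}_r$-unitary; \item a \emph{c.n.i. (completely non-isometry) $\mathbb{A}_r$-contraction} if $T$ is an $\mathbb{A}_r$-contraction and no non-zero closed subspace reduces $T$ to an $\mathbb{A}_r$-isometry. \end{itemize} Let $T$ be a c.n.u. $\mathbb{A}_r$-contraction on a Hilbert space $\mathcal{H}$. Then there is a unique orthogonal decomposition $\mathcal{H}=\mathcal{H}_1\oplus\mathcal{H}_2$ into closed subspaces reducing $T$ such that $T|_{\mathcal{H}_1}$ is a pure $\mathbb{A}_r$-isometry and $T|_{\mathcal{H}_2}$ is a c.n.i. $\mathbb{A}_r$-contraction. (Either of $\mathcal{H}_1$, $\mathcal{H}_2$ may be $\{0\}$.) -/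

import Mathlib

universe u

noncomputable section

namespace Annulus

/-- The closed annulus `{z : r ≤ |z| ≤ 1}`. -/
def closedAnnulus (r : ℝ) : Set ℂ := {z | r ≤ ‖z‖ ∧ ‖z‖ ≤ 1}

/-- The (distinguished) boundary of the annulus: the union of the circles of radii `r` and `1`. -/
def boundary (r : ℝ) : Set ℂ := {z | ‖z‖ = r ∨ ‖z‖ = 1}

/-- For `0 < r < 1` the closed annulus is the closure of the open annulus `{z : r < |z| < 1}`. -/
theorem closure_annulus {r : ℝ} (hr0 : 0 < r) (hr1 : r < 1) :
    closure {z : ℂ | r < ‖z‖ ∧ ‖z‖ < 1} = closedAnnulus r := by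
  apply Set.Subset.antisymm
  · refine closure_minimal (fun z hz => ⟨hz.1.le, hz.2.le⟩) ?_
    exact (isClosed_le continuous_const continuous_norm).inter
      (isClosed_le continuous_norm continuous_const)
  · rintro z ⟨hz0, hz1⟩
    have hzpos : 0 < ‖z‖ := hr0.trans_le hz0
    have hlim : Filter.Tendsto (fun t : ℝ => ((1 - t + t * ((r + 1) / 2 / ‖z‖) : ℝ) : ℂ) * z)
        (nhdsWithin 0 (Set.Ioo 0 1)) (nhds z) := by
      have hc : Continuous (fun t : ℝ => ((1 - t + t * ((r + 1) / 2 / ‖z‖) : ℝ) : ℂ) * z) := by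
        fun_prop
      have h := (hc.tendsto 0).mono_left (nhdsWithin_le_nhds (s := Set.Ioo (0 : ℝ) 1))
      simpa using h
    have : (nhdsWithin (0 : ℝ) (Set.Ioo 0 1)).NeBot := by
      rw [← mem_closure_iff_nhdsWithin_neBot, closure_Ioo (by norm_num)]
      simp
    refine mem_closure_of_tendsto hlim ?_
    filter_upwards [self_mem_nhdsWithin] with t ht
    obtain ⟨ht0, ht1⟩ := ht
    have hnn : 0 ≤ 1 - t + t * ((r + 1) / 2 / ‖z‖) :=
      add_nonneg (by linarith) (by positivity)
    have hnorm : ‖((1 - t + t * ((r + 1) / 2 / ‖z‖) : ℝ) : ℂ) * z‖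
        = (1 - t) * ‖z‖ + t * ((r + 1) / 2) := by
      rw [norm_mul, Complex.norm_real, Real.norm_of_nonneg hnn]
      field_simp
    change r < ‖_‖ ∧ ‖_‖ < 1
    rw [hnorm]
    constructor <;> nlinarith

/-- `p(T) q(T)⁻¹`, the value at the operator `T` of the rational function `p / q`. It is the
genuine quotient when `q` has no zero on the spectrum of `T`, since `q(T)` is then invertible. -/
def ratEval {H : Type u} [NormedAddCommGroup H] [InnerProductSpace ℂ H]
    (p q : Polynomial ℂ) (T : H →L[ℂ] H) : H →L[ℂ] H :=
  Polynomial.aeval T p * Ring.inverse (Polynomial.aeval T q)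

/-- `T` is an `𝔸_r`-contraction: the closed annulus is a spectral set for `T`, that is, it contains
the spectrum of `T` and von Neumann's inequality holds on it for all rational functions with poles
off the closed annulus. -/
structure IsContraction {H : Type u} [NormedAddCommGroup H] [InnerProductSpace ℂ H]
    (r : ℝ) (T : H →L[ℂ] H) : Prop where
  spectrum_subset : spectrum ℂ T ⊆ closedAnnulus r
  norm_ratEval_le : ∀ p q : Polynomial ℂ, (∀ z ∈ closedAnnulus r, q.eval z ≠ 0) →
    ‖ratEval p q T‖ ≤ sSup ((fun z : ℂ => ‖p.eval z / q.eval z‖) '' closedAnnulus r)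

/-- `T` is an `𝔸_r`-unitary: a normal operator with spectrum in the boundary of the annulus. -/
structure IsUnitary {H : Type u} [NormedAddCommGroup H] [InnerProductSpace ℂ H] [CompleteSpace H]
    (r : ℝ) (T : H →L[ℂ] H) : Prop where
  isStarNormal : IsStarNormal T
  spectrum_subset : spectrum ℂ T ⊆ boundary r

/-- `T` is an `𝔸_r`-isometry: its spectrum lies in the closed annulus, and it is the restriction of
an `𝔸_r`-unitary `U` on a larger Hilbert space `K` to an invariant subspace. Here `H` is regarded
as a subspace of `K` through a linear isometry `J`, and `U ∘ J = J ∘ T` says that the image of `J`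
is invariant under `U` and that `U` acts on it as `T`. (Allowing `K` in higher universes would give
the same notion, since `K` can be cut down to the reducing subspace of `U` generated by `H`.) -/
structure IsIsometry {H : Type u} [NormedAddCommGroup H] [InnerProductSpace ℂ H]
    (r : ℝ) (T : H →L[ℂ] H) : Prop where
  spectrum_subset : spectrum ℂ T ⊆ closedAnnulus r
  exists_extension : ∃ (K : Type u) (_ : NormedAddCommGroup K) (_ : InnerProductSpace ℂ K)
    (_ : CompleteSpace K) (U : K →L[ℂ] K) (J : H →ₗᵢ[ℂ] K),
    IsUnitary r U ∧ ∀ x : H, U (J x) = J (T x)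

/-- A closed subspace of a Hilbert space is a Hilbert space. -/
instance completeSpace_toSubmodule {H : Type u} [NormedAddCommGroup H] [InnerProductSpace ℂ H]
    [CompleteSpace H] (L : ClosedSubmodule ℂ H) : CompleteSpace L.toSubmodule :=
  L.isClosed.completeSpace_coe

/-- The closed subspace `L` reduces `T`: it is invariant under `T` and under its adjoint. -/
structure Reduces {H : Type u} [NormedAddCommGroup H] [InnerProductSpace ℂ H] [CompleteSpace H]
    (L : ClosedSubmodule ℂ H) (T : H →L[ℂ] H) : Prop where
  map_mem : ∀ x ∈ L, T x ∈ L
  adjoint_map_mem : ∀ x ∈ L, ContinuousLinearMap.adjoint T x ∈ L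

/-- The restriction `T|_L` of `T` to a closed subspace `L` that reduces `T`, as an operator
on `L`. -/
def Reduces.restrict {H : Type u} [NormedAddCommGroup H] [InnerProductSpace ℂ H] [CompleteSpace H]
    {L : ClosedSubmodule ℂ H} {T : H →L[ℂ] H} (h : Reduces L T) :
    L.toSubmodule →L[ℂ] L.toSubmodule :=
  ContinuousLinearMap.restrict T (p := L.toSubmodule) (q := L.toSubmodule) h.map_mem

/-- `T` is a pure `𝔸_r`-isometry: an `𝔸_r`-isometry such that no non-zero closed subspace reduces
it to an `𝔸_r`-unitary. -/
structure IsPureIsometry {H : Type u} [NormedAddCommGroup H] [InnerProductSpace ℂ H]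
    [CompleteSpace H] (r : ℝ) (T : H →L[ℂ] H) : Prop where
  isIsometry : IsIsometry r T
  eq_bot : ∀ (L : ClosedSubmodule ℂ H) (h : Reduces L T), IsUnitary r h.restrict → L = ⊥

/-- `T` is a completely non-unitary (c.n.u.) `𝔸_r`-contraction: an `𝔸_r`-contraction such that no
non-zero closed subspace reduces it to an `𝔸_r`-unitary. -/
structure IsCNUContraction {H : Type u} [NormedAddCommGroup H] [InnerProductSpace ℂ H]
    [CompleteSpace H] (r : ℝ) (T : H →L[ℂ] H) : Prop where
  isContraction : IsContraction r T
  eq_bot : ∀ (L : ClosedSubmodule ℂ H) (h : Reduces L T), IsUnitary r h.restrict → L = ⊥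

/-- `T` is a completely non-isometry (c.n.i.) `𝔸_r`-contraction: an `𝔸_r`-contraction such that no
non-zero closed subspace reduces it to an `𝔸_r`-isometry. -/
structure IsCNIContraction {H : Type u} [NormedAddCommGroup H] [InnerProductSpace ℂ H]
    [CompleteSpace H] (r : ℝ) (T : H →L[ℂ] H) : Prop where
  isContraction : IsContraction r T
  eq_bot : ∀ (L : ClosedSubmodule ℂ H) (h : Reduces L T), IsIsometry r h.restrict → L = ⊥

end Annulus

end

/-!
The idea is that being an `𝔸_r`-isometry, which by definition refers to an extension on another
space, is for a contraction an identity between operators on the given space: the vanishing of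
`defect r T = T*²T² - (1 + r²) T*T + r²` (`IsContraction.isIsometry_iff`).

A normal `U` is an `𝔸_r`-unitary exactly when its defect is zero, since the defect corresponds to
`(|z|² - 1)(|z|² - r²)` in the functional calculus. The quadratic form of the defect of `T` at `x`
involves only `‖x‖`, `‖T x‖` and `‖T² x‖`, so its vanishing passes to restrictions. Conversely, if
the defect of a contraction vanishes, then `1 = A + B` with positive `A` and `B` such that `T`
preserves the form of `A` and multiplies that of `B` by `r²`. As `T` is invertible, it induces a
unitary `V₁` and `r` times a unitary `V₂` on the closed ranges of `√A` and `√B`, and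
`x ↦ (√A x, √B x)` embeds `T` isometrically into the `𝔸_r`-unitary `V₁ ⊕ r V₂`.

The defect commutes with restriction to reducing subspaces, and its vanishing on reducing subspaces
is stable under closed linear spans. Hence there is a largest reducing subspace `isometricPart r T`
on which a contraction `T` is an isometry, and the reducing subspaces with this property are those
contained in it. It and its orthogonal complement give the decomposition. In any other
decomposition the first summand lies in `isometricPart r T`, and the second meets it only in `0`,
which forces equality.
-/

namespace Annulus

open ContinuousLinearMap

/-! ### The defect operator -/

section Defect

variable {H : Type u} [NormedAddCommGroup H] [InnerProductSpace ℂ H] [CompleteSpace H]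

/-- The operator `T*²T² - (1 + r²) T*T + r²`. For normal `T` it is the value at `T` of the function
`(|z|² - 1)(|z|² - r²)`, whose zero set is the boundary of the annulus. -/
noncomputable def defect (r : ℝ) (T : H →L[ℂ] H) : H →L[ℂ] H :=
  star T * (star T * T) * T - ((1 + r ^ 2 : ℝ) : ℂ) • (star T * T) + ((r ^ 2 : ℝ) : ℂ) • 1

/-- The quadratic form of the defect depends only on norms along the orbit of `x`. -/
theorem inner_defect_self (r : ℝ) (T : H →L[ℂ] H) (x : H) :
    inner ℂ (defect r T x) x =
      ((‖T (T x)‖ ^ 2 - (1 + r ^ 2) * ‖T x‖ ^ 2 + r ^ 2 * ‖x‖ ^ 2 : ℝ) : ℂ) := by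
  simp only [defect, star_eq_adjoint, add_apply, sub_apply, mul_apply_eq_comp, smul_apply,
    one_apply_eq_self, inner_add_left, inner_sub_left, inner_smul_left, adjoint_inner_left,
    Complex.conj_ofReal, inner_self_eq_norm_sq_to_K]
  push_cast
  rfl

/-- On a complex Hilbert space an operator is determined by its quadratic form. -/
theorem defect_eq_zero_iff (r : ℝ) (T : H →L[ℂ] H) : defect r T = 0 ↔
    ∀ x, ‖T (T x)‖ ^ 2 - (1 + r ^ 2) * ‖T x‖ ^ 2 + r ^ 2 * ‖x‖ ^ 2 = 0 := by
  have h := inner_map_self_eq_zero (defect r T : H →ₗ[ℂ] H)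
  simp only [coe_coe, inner_defect_self, Complex.ofReal_eq_zero] at h
  rw [h]
  exact (coe_inj (g := (0 : H →L[ℂ] H))).symm

theorem defect_eq_cfc (r : ℝ) (U : H →L[ℂ] H) [IsStarNormal U] :
    defect r U = cfc (fun z : ℂ => (((‖z‖ ^ 2 - 1) * (‖z‖ ^ 2 - r ^ 2) : ℝ) : ℂ)) U := by
  have h : (fun z : ℂ => (((‖z‖ ^ 2 - 1) * (‖z‖ ^ 2 - r ^ 2) : ℝ) : ℂ)) =
      fun z => star z * (star z * z) * z - ((1 + r ^ 2 : ℝ) : ℂ) • (star z * z)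
        + ((r ^ 2 : ℝ) : ℂ) := by
    ext z
    have hz : star z * z = ((‖z‖ ^ 2 : ℝ) : ℂ) := by
      simpa using Complex.conj_mul' z
    have hz' : star z * (star z * z) * z = ((‖z‖ ^ 2 : ℝ) : ℂ) * ((‖z‖ ^ 2 : ℝ) : ℂ) := by
      rw [← hz]; ring
    rw [hz', hz, smul_eq_mul]
    push_cast
    ring
  rw [h, cfc_add .., cfc_sub .., cfc_mul .., cfc_mul .., cfc_smul .., cfc_mul .., cfc_star_id ..,
    cfc_id' .., cfc_const .., Algebra.algebraMap_eq_smul_one]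
  rfl

theorem isUnitary_iff_defect_eq_zero {r : ℝ} (hr : 0 ≤ r) (U : H →L[ℂ] H) :
    IsUnitary r U ↔ IsStarNormal U ∧ defect r U = 0 := by
  have key (z : ℂ) : (((‖z‖ ^ 2 - 1) * (‖z‖ ^ 2 - r ^ 2) : ℝ) : ℂ) = 0 ↔ z ∈ boundary r := by
    rw [Complex.ofReal_eq_zero, mul_eq_zero, sub_eq_zero, sub_eq_zero,
      sq_eq_sq₀ (norm_nonneg z) hr, pow_eq_one_iff_of_nonneg (norm_nonneg z) two_ne_zero,
      or_comm]
    rfl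
  constructor
  · rintro ⟨hn, hs⟩
    refine ⟨hn, ?_⟩
    rw [defect_eq_cfc, cfc_congr (g := fun _ => (0 : ℂ)) fun z hz => (key z).2 (hs hz)]
    exact cfc_const_zero ℂ U
  · rintro ⟨hn, h0⟩
    refine ⟨hn, fun z hz => (key z).1 ?_⟩
    -- on the zero space the spectrum is empty
    have : Nontrivial (H →L[ℂ] H) := by
      by_contra hc
      rw [not_nontrivial_iff_subsingleton] at hc
      exact hz (isUnit_of_subsingleton _)
    have hm := cfc_map_spectrum (fun z : ℂ => (((‖z‖ ^ 2 - 1) * (‖z‖ ^ 2 - r ^ 2) : ℝ) : ℂ)) U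
    rw [← defect_eq_cfc, h0, spectrum.zero_eq] at hm
    exact hm.symm.subset (Set.mem_image_of_mem _ hz)

theorem IsIsometry.defect_eq_zero {r : ℝ} (hr : 0 ≤ r) {T : H →L[ℂ] H} (hT : IsIsometry r T) :
    defect r T = 0 := by
  obtain ⟨-, K, _, _, _, U, J, hU, hJ⟩ := hT
  have h0 := (defect_eq_zero_iff r U).1 ((isUnitary_iff_defect_eq_zero hr U).1 hU).2
  refine (defect_eq_zero_iff r T).2 fun x => ?_
  simpa only [hJ, LinearIsometry.norm_map] using h0 (J x)

end Defect

/-! ### Contractions and their bounds -/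

section Contraction

variable {H : Type u} [NormedAddCommGroup H] [InnerProductSpace ℂ H]

theorem IsContraction.isUnit {r : ℝ} (hr : 0 < r) {T : H →L[ℂ] H} (hT : IsContraction r T) :
    IsUnit T := by
  by_contra h
  have h0 := (hT.spectrum_subset ((spectrum.zero_mem_iff ℂ).2 h)).1
  rw [norm_zero] at h0
  linarith

theorem IsContraction.norm_apply_le {r : ℝ} {T : H →L[ℂ] H} (hT : IsContraction r T) (x : H) :
    ‖T x‖ ≤ ‖x‖ := by
  have h := hT.norm_ratEval_le Polynomial.X 1 (by simp)
  -- the rational function `z`, bounded by `1` on the annulus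
  have h1 : ‖T‖ ≤ 1 := by
    refine (le_of_eq (by simp [ratEval])).trans (h.trans (Real.sSup_le ?_ zero_le_one))
    rintro _ ⟨z, hz, rfl⟩
    simpa using hz.2
  simpa using T.le_of_opNorm_le h1 x

theorem IsContraction.le_norm_apply {r : ℝ} (hr : 0 < r) {T : H →L[ℂ] H} (hT : IsContraction r T)
    (x : H) : r * ‖x‖ ≤ ‖T x‖ := by
  -- the rational function `1 / z`, bounded by `1 / r` on the annulus
  have h := hT.norm_ratEval_le 1 Polynomial.X fun z hz h0 => by
    rw [Polynomial.eval_X] at h0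
    rw [h0] at hz
    have := hz.1
    rw [norm_zero] at this
    linarith
  have h1 : ‖Ring.inverse T‖ ≤ r⁻¹ := by
    refine (le_of_eq (by simp [ratEval])).trans (h.trans (Real.sSup_le ?_ (by positivity)))
    rintro _ ⟨z, hz, rfl⟩
    simpa using inv_anti₀ hr hz.1
  have h2 := (Ring.inverse T).le_of_opNorm_le h1 (T x)
  rw [← mul_apply_eq_comp, Ring.inverse_mul_cancel _ (hT.isUnit hr), one_apply_eq_self,
    inv_mul_eq_div, le_div_iff₀ hr] at h2
  linarith

end Contraction

/-! ### Contractions with vanishing defect are isometries -/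

section Extension

variable {H : Type u} [NormedAddCommGroup H] [InnerProductSpace ℂ H] [CompleteSpace H]

theorem exists_norm_sq_eq_inner_of_nonneg {A : H →L[ℂ] H} (hA : 0 ≤ A) :
    ∃ R : H →L[ℂ] H, ∀ x, ‖R x‖ ^ 2 = A.reApplyInnerSelf x := by
  refine ⟨CFC.sqrt A, fun x => ?_⟩
  have h : adjoint (CFC.sqrt A) = CFC.sqrt A :=
    (CFC.sqrt_nonneg A).isSelfAdjoint.star_eq
  rw [reApplyInnerSelf_apply]
  conv_rhs => rw [← CFC.sqrt_mul_sqrt_self A hA, mul_apply_eq_comp]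
  nth_rw 2 [← h]
  rw [adjoint_inner_left, inner_self_eq_norm_sq]

/-- An invertible operator `T` preserving the seminorm `‖R x‖` descends, along `R`, to a unitary
operator on the closure of the range of `R`; invertibility is what makes it surjective. -/
theorem exists_unitary_of_norm_eq (T : H ≃ₗ[ℂ] H) (R : H →L[ℂ] H)
    (hR : ∀ x, ‖R (T x)‖ = ‖R x‖) :
    ∃ (K : Type u) (_ : NormedAddCommGroup K) (_ : InnerProductSpace ℂ K) (_ : CompleteSpace K)
      (V : K ≃ₗᵢ[ℂ] K) (S : H →ₗ[ℂ] K), (∀ x, V (S x) = S (T x)) ∧ ∀ x, ‖S x‖ = ‖R x‖ := by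
  let K := (LinearMap.range (R : H →ₗ[ℂ] H)).topologicalClosure
  have : CompleteSpace K := (Submodule.isClosed_topologicalClosure _).completeSpace_coe
  let S : H →ₗ[ℂ] K := (R : H →ₗ[ℂ] H).codRestrict K fun x =>
    Submodule.le_topologicalClosure _ (LinearMap.mem_range_self _ x)
  have hS : DenseRange S := by
    intro y
    rw [closure_subtype, ← Set.range_comp]
    exact y.2
  exact ⟨K, inferInstance, inferInstance, inferInstance,
    T.extendOfIsometry S S hS hS fun x => hR x, S, T.extendOfIsometry_eq S S hS hS _, fun x => rfl⟩

/-- The orthogonal sum `V₁ ⊕ r V₂`, with `V₁` and `V₂` unitary, is an `𝔸_r`-unitary. -/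
theorem exists_isUnitary_prod {r : ℝ} (hr : 0 ≤ r)
    {K₁ K₂ : Type u} [NormedAddCommGroup K₁] [InnerProductSpace ℂ K₁] [CompleteSpace K₁]
    [NormedAddCommGroup K₂] [InnerProductSpace ℂ K₂] [CompleteSpace K₂]
    (V₁ : K₁ ≃ₗᵢ[ℂ] K₁) (V₂ : K₂ ≃ₗᵢ[ℂ] K₂) :
    ∃ U : WithLp 2 (K₁ × K₂) →L[ℂ] WithLp 2 (K₁ × K₂), IsUnitary r U ∧
      ∀ a b, U (WithLp.toLp 2 (a, b)) = WithLp.toLp 2 (V₁ a, (r : ℂ) • V₂ b) := by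
  let e := WithLp.prodContinuousLinearEquiv 2 ℂ K₁ K₂
  let sum (A : K₁ →L[ℂ] K₁) (B : K₂ →L[ℂ] K₂) : WithLp 2 (K₁ × K₂) →L[ℂ] WithLp 2 (K₁ × K₂) :=
    (e.symm : K₁ × K₂ →L[ℂ] WithLp 2 (K₁ × K₂)) ∘L (A.prodMap B) ∘L
      (e : WithLp 2 (K₁ × K₂) →L[ℂ] K₁ × K₂)
  have sum_apply (A B) (x : WithLp 2 (K₁ × K₂)) :
      sum A B x = WithLp.toLp 2 (A x.fst, B x.snd) := rfl
  let U := sum V₁ ((r : ℂ) • V₂)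
  let U' := sum V₁.symm ((r : ℂ) • V₂.symm)
  have hU : star U = U' := by
    refine ((eq_adjoint_iff U' U).2 fun x y => ?_).symm
    have h₁ : inner ℂ (V₁.symm x.fst) y.fst = inner ℂ x.fst (V₁ y.fst) := by
      rw [← V₁.inner_map_map, V₁.apply_symm_apply]
    have h₂ : inner ℂ (V₂.symm x.snd) y.snd = inner ℂ x.snd (V₂ y.snd) := by
      rw [← V₂.inner_map_map, V₂.apply_symm_apply]
    simp only [U, U', sum_apply, WithLp.prod_inner_apply]
    change inner ℂ (V₁.symm x.fst) y.fst + inner ℂ ((r : ℂ) • V₂.symm x.snd) y.snd =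
      inner ℂ x.fst (V₁ y.fst) + inner ℂ x.snd ((r : ℂ) • V₂ y.snd)
    rw [inner_smul_left, inner_smul_right, Complex.conj_ofReal, h₁, h₂]
  refine ⟨U, (isUnitary_iff_defect_eq_zero hr U).2 ⟨⟨?_⟩, ?_⟩, fun a b => rfl⟩
  · rw [hU]
    ext x : 1
    change U' (U x) = U (U' x)
    simp [U, U', sum_apply]
  · rw [defect_eq_zero_iff]
    intro x
    have h (x : WithLp 2 (K₁ × K₂)) : ‖U x‖ ^ 2 = ‖x.fst‖ ^ 2 + r ^ 2 * ‖x.snd‖ ^ 2 := by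
      rw [WithLp.prod_norm_sq_eq_of_L2]
      simp [U, sum_apply, norm_smul, mul_pow]
    have h' : ‖(U x).fst‖ = ‖x.fst‖ ∧ ‖(U x).snd‖ = r * ‖x.snd‖ := by
      simp [U, sum_apply, norm_smul, abs_of_nonneg hr]
    rw [h, h, WithLp.prod_norm_sq_eq_of_L2, h'.1, h'.2]
    ring

/-- With `A = (T*T - r²) / (1 - r²)` and `B = (1 - T*T) / (1 - r²)`, both positive, the vanishing
of the defect says that `T` preserves `⟨A x, x⟩` and scales `⟨B x, x⟩` by `r²`; since `A + B = 1`,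
the map `x ↦ (√A x, √B x)` is an isometry that carries `T` into a sum `V₁ ⊕ r V₂`. -/
theorem IsContraction.isIsometry_of_defect_eq_zero {r : ℝ} (hr0 : 0 < r) (hr1 : r < 1)
    {T : H →L[ℂ] H} (hT : IsContraction r T) (h0 : defect r T = 0) : IsIsometry r T := by
  refine ⟨hT.spectrum_subset, ?_⟩
  rw [defect_eq_zero_iff] at h0
  have hd : 0 < 1 - r ^ 2 := by nlinarith
  let c : ℂ := (((1 - r ^ 2)⁻¹ : ℝ) : ℂ)
  let A : H →L[ℂ] H := c • (star T * T - ((r ^ 2 : ℝ) : ℂ) • 1)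
  let B : H →L[ℂ] H := c • (1 - star T * T)
  have hAx (x : H) : A.reApplyInnerSelf x = (1 - r ^ 2)⁻¹ * (‖T x‖ ^ 2 - r ^ 2 * ‖x‖ ^ 2) := by
    simp only [A, c, reApplyInnerSelf_apply, star_eq_adjoint, sub_apply, mul_apply_eq_comp,
      smul_apply, one_apply_eq_self, inner_sub_left, inner_smul_left, adjoint_inner_left,
      Complex.conj_ofReal, inner_self_eq_norm_sq_to_K]
    exact Eq.trans (by push_cast; rfl) (Complex.ofReal_re _)
  have hBx (x : H) : B.reApplyInnerSelf x = (1 - r ^ 2)⁻¹ * (‖x‖ ^ 2 - ‖T x‖ ^ 2) := by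
    simp only [B, c, reApplyInnerSelf_apply, star_eq_adjoint, sub_apply, mul_apply_eq_comp,
      smul_apply, one_apply_eq_self, inner_sub_left, inner_smul_left, adjoint_inner_left,
      Complex.conj_ofReal, inner_self_eq_norm_sq_to_K]
    exact Eq.trans (by push_cast; rfl) (Complex.ofReal_re _)
  have hc : IsSelfAdjoint c := Complex.conj_ofReal _
  have hA : 0 ≤ A := by
    refine (nonneg_iff_isPositive A).2 (isPositive_def'.2 ⟨?_, fun x => ?_⟩)
    · exact hc.smul ((IsSelfAdjoint.star_mul_self T).sub
        (IsSelfAdjoint.smul (Complex.conj_ofReal _) (.one _)))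
    · rw [hAx]
      have := pow_le_pow_left₀ (by positivity) (hT.le_norm_apply hr0 x) 2
      exact mul_nonneg (by positivity) (by linarith [mul_pow r ‖x‖ 2])
  have hB : 0 ≤ B := by
    refine (nonneg_iff_isPositive B).2 (isPositive_def'.2 ⟨?_, fun x => ?_⟩)
    · exact hc.smul ((IsSelfAdjoint.one _).sub (IsSelfAdjoint.star_mul_self T))
    · rw [hBx]
      have := pow_le_pow_left₀ (by positivity) (hT.norm_apply_le x) 2
      exact mul_nonneg (by positivity) (by linarith)
  obtain ⟨R₁, hR₁⟩ := exists_norm_sq_eq_inner_of_nonneg hA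
  obtain ⟨R₂, hR₂⟩ := exists_norm_sq_eq_inner_of_nonneg hB
  have hrc : (r : ℂ) ≠ 0 := Complex.ofReal_ne_zero.2 hr0.ne'
  let E : H ≃ₗ[ℂ] H := LinearEquiv.ofBijective (T : H →ₗ[ℂ] H)
    (isUnit_iff_bijective.1 (hT.isUnit hr0))
  obtain ⟨K₁, _, _, _, V₁, S₁, hV₁, hS₁⟩ := exists_unitary_of_norm_eq E R₁ fun x => by
    rw [← sq_eq_sq₀ (norm_nonneg _) (norm_nonneg _), hR₁, hR₁, hAx, hAx]
    change _ * (‖T (T x)‖ ^ 2 - r ^ 2 * ‖T x‖ ^ 2) = _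
    linear_combination (1 - r ^ 2)⁻¹ * h0 x
  obtain ⟨K₂, _, _, _, V₂, S₂, hV₂, hS₂⟩ := exists_unitary_of_norm_eq
      (E.trans (LinearEquiv.smulOfNeZero ℂ H (r : ℂ)⁻¹ (inv_ne_zero hrc))) R₂ fun x => by
    change ‖R₂ ((r : ℂ)⁻¹ • T x)‖ = _
    rw [map_smul, norm_smul, norm_inv, Complex.norm_real, Real.norm_of_nonneg hr0.le,
      inv_mul_eq_iff_eq_mul₀ hr0.ne', ← sq_eq_sq₀ (norm_nonneg _) (by positivity), mul_pow, hR₂,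
      hR₂, hBx, hBx]
    linear_combination -(1 - r ^ 2)⁻¹ * h0 x
  obtain ⟨U, hU, hUx⟩ := exists_isUnitary_prod hr0.le V₁ V₂
  let J : H →ₗᵢ[ℂ] WithLp 2 (K₁ × K₂) :=
    { toLinearMap := (WithLp.linearEquiv 2 ℂ (K₁ × K₂)).symm.toLinearMap ∘ₗ S₁.prod S₂
      norm_map' := fun x => by
        rw [← sq_eq_sq₀ (norm_nonneg _) (norm_nonneg _), WithLp.prod_norm_sq_eq_of_L2]
        change ‖S₁ x‖ ^ 2 + ‖S₂ x‖ ^ 2 = _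
        rw [hS₁, hS₂, hR₁, hR₂, hAx, hBx]
        field_simp
        ring }
  refine ⟨_, inferInstance, inferInstance, inferInstance, U, J, hU, fun x => ?_⟩
  change U (WithLp.toLp 2 (S₁ x, S₂ x)) = WithLp.toLp 2 (S₁ (T x), S₂ (T x))
  rw [hUx, hV₁, hV₂]
  change WithLp.toLp 2 (S₁ (T x), (r : ℂ) • S₂ ((r : ℂ)⁻¹ • T x)) = _
  rw [map_smul, smul_inv_smul₀ hrc]

/-- The existence of an `𝔸_r`-unitary extension is decided by an operator identity. -/
theorem IsContraction.isIsometry_iff {r : ℝ} (hr0 : 0 < r) (hr1 : r < 1)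
    {T : H →L[ℂ] H} (hT : IsContraction r T) : IsIsometry r T ↔ defect r T = 0 :=
  ⟨IsIsometry.defect_eq_zero hr0.le, hT.isIsometry_of_defect_eq_zero hr0 hr1⟩

end Extension

/-! ### Reducing subspaces -/

section Reducing

variable {H : Type u} [NormedAddCommGroup H] [InnerProductSpace ℂ H] [CompleteSpace H]
  {T : H →L[ℂ] H} {L M : ClosedSubmodule ℂ H}

theorem Reduces.coe_restrict_apply (h : Reduces L T) (x : L.toSubmodule) :
    (h.restrict x : H) = T x := rfl

theorem Reduces.coe_adjoint_restrict_apply (h : Reduces L T) (x : L.toSubmodule) :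
    (adjoint h.restrict x : H) = adjoint T x := by
  let S : L.toSubmodule →L[ℂ] L.toSubmodule :=
    ContinuousLinearMap.restrict (adjoint T) (p := L.toSubmodule) (q := L.toSubmodule)
      h.adjoint_map_mem
  have hS : S = adjoint h.restrict :=
    (eq_adjoint_iff S h.restrict).2 fun x y => adjoint_inner_left T (y : H) (x : H)
  rw [← hS]
  rfl

theorem Reduces.coe_defect_restrict_apply (h : Reduces L T) (r : ℝ) (x : L.toSubmodule) :
    (defect r h.restrict x : H) = defect r T x := by
  simp only [defect, star_eq_adjoint, add_apply, sub_apply, mul_apply_eq_comp, smul_apply,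
    one_apply_eq_self, Submodule.coe_add, Submodule.coe_sub, Submodule.coe_smul,
    h.coe_adjoint_restrict_apply, h.coe_restrict_apply]

theorem Reduces.defect_restrict_eq_zero_iff (h : Reduces L T) (r : ℝ) :
    defect r h.restrict = 0 ↔ ∀ x ∈ L, defect r T x = 0 := by
  constructor
  · intro h0 x hx
    have := h.coe_defect_restrict_apply r ⟨x, hx⟩
    rw [h0] at this
    exact this.symm
  · intro h0
    ext x
    exact (h.coe_defect_restrict_apply r x).trans (h0 x x.2)

theorem Reduces.orthogonal (h : Reduces L T) : Reduces Lᗮ T where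
  map_mem x hx u hu := by
    rw [← adjoint_inner_left]
    exact hx _ (h.adjoint_map_mem u hu)
  adjoint_map_mem x hx u hu := by
    rw [adjoint_inner_right]
    exact hx _ (h.map_mem u hu)

theorem reduces_sSup {s : Set (ClosedSubmodule ℂ H)} (hs : ∀ L ∈ s, Reduces L T) :
    Reduces (sSup s) T where
  map_mem := by
    have : sSup s ≤ (sSup s).comap T :=
      sSup_le fun L hL x hx => le_sSup hL ((hs L hL).map_mem x hx)
    exact this
  adjoint_map_mem := by
    have : sSup s ≤ (sSup s).comap (adjoint T) :=
      sSup_le fun L hL x hx => le_sSup hL ((hs L hL).adjoint_map_mem x hx)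
    exact this

theorem Reduces.spectrum_restrict_subset (h : Reduces L T) :
    spectrum ℂ h.restrict ⊆ spectrum ℂ T := by
  intro z hz hu
  refine hz (isUnit_iff_bijective.2 ?_)
  have hb := isUnit_iff_bijective.1 hu
  have hcoe (x : L.toSubmodule) :
      ((algebraMap ℂ (L.toSubmodule →L[ℂ] L.toSubmodule) z - h.restrict) x : H) =
        (algebraMap ℂ (H →L[ℂ] H) z - T) x := rfl
  refine ⟨fun x y hxy => Subtype.ext (hb.1 ?_), fun y => ?_⟩
  · rw [← hcoe, ← hcoe, hxy]
  · obtain ⟨x, hx⟩ := hb.2 (y : H)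
    obtain ⟨a, ha, b, hb', rfl⟩ := L.toSubmodule.exists_add_mem_mem_orthogonal x
    refine ⟨⟨a, ha⟩, Subtype.ext ?_⟩
    rw [hcoe, ← hx, map_add]
    -- `(z - T) b` lies both in `L` and in its orthogonal complement
    have h₁ : (algebraMap ℂ (H →L[ℂ] H) z - T) b ∈ L.toSubmodule := by
      have h₂ : (algebraMap ℂ (H →L[ℂ] H) z - T) b = y - (algebraMap ℂ (H →L[ℂ] H) z - T) a := by
        rw [← hx, map_add, add_sub_cancel_left]
      rw [h₂]
      exact sub_mem y.2 (sub_mem (L.toSubmodule.smul_mem z ha) (h.map_mem a ha))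
    have h₂ : (algebraMap ℂ (H →L[ℂ] H) z - T) b ∈ L.toSubmoduleᗮ :=
      sub_mem (L.toSubmoduleᗮ.smul_mem z hb') (h.orthogonal.map_mem b hb')
    rw [L.toSubmodule.inf_orthogonal_eq_bot.le ⟨h₁, h₂⟩, add_zero]

theorem Reduces.coe_aeval_restrict_apply (h : Reduces L T) (p : Polynomial ℂ)
    (x : L.toSubmodule) :
    (Polynomial.aeval h.restrict p x : H) = Polynomial.aeval T p x := by
  induction p using Polynomial.induction_on' generalizing x with
  | add p q hp hq => simp [hp, hq]
  | monomial n a =>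
    have hn : ((h.restrict ^ n) x : H) = (T ^ n) x := by
      induction n generalizing x with
      | zero => rfl
      | succ n ih => rw [pow_succ, pow_succ, mul_apply_eq_comp, mul_apply_eq_comp, ih]; rfl
    simp only [Polynomial.aeval_monomial, mul_apply_eq_comp, ← hn]
    rfl

theorem isUnit_aeval_of_forall_eval_ne_zero {K : Type*} [NormedAddCommGroup K]
    [InnerProductSpace ℂ K] [CompleteSpace K] {S : K →L[ℂ] K} {q : Polynomial ℂ}
    (hq : ∀ z ∈ spectrum ℂ S, q.eval z ≠ 0) : IsUnit (Polynomial.aeval S q) := by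
  nontriviality K →L[ℂ] K
  by_contra hc
  have h0 := (spectrum.zero_mem_iff ℂ).2 hc
  rw [spectrum.map_polynomial_aeval] at h0
  obtain ⟨z, hz, hz0⟩ := h0
  exact hq z hz hz0

theorem Reduces.coe_ratEval_restrict_apply (h : Reduces L T) (p : Polynomial ℂ)
    {q : Polynomial ℂ} (hq : ∀ z ∈ spectrum ℂ T, q.eval z ≠ 0) (x : L.toSubmodule) :
    (ratEval p q h.restrict x : H) = ratEval p q T x := by
  have hu : IsUnit (Polynomial.aeval T q) := isUnit_aeval_of_forall_eval_ne_zero hq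
  have hu' : IsUnit (Polynomial.aeval h.restrict q) :=
    isUnit_aeval_of_forall_eval_ne_zero fun z hz => hq z (h.spectrum_restrict_subset hz)
  have hx : Ring.inverse (Polynomial.aeval T q) (x : H) =
      (Ring.inverse (Polynomial.aeval h.restrict q) x : L.toSubmodule) := by
    refine (isUnit_iff_bijective.1 hu).1 ?_
    rw [← h.coe_aeval_restrict_apply, ← mul_apply_eq_comp, ← mul_apply_eq_comp,
      Ring.mul_inverse_cancel _ hu, Ring.mul_inverse_cancel _ hu', one_apply_eq_self,
      one_apply_eq_self]
  rw [ratEval, ratEval, mul_apply_eq_comp, mul_apply_eq_comp, h.coe_aeval_restrict_apply, hx]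

theorem IsContraction.restrict {r : ℝ} (hT : IsContraction r T) (h : Reduces L T) :
    IsContraction r h.restrict := by
  refine ⟨h.spectrum_restrict_subset.trans hT.spectrum_subset, fun p q hq => ?_⟩
  refine le_trans (opNorm_le_bound _ (norm_nonneg (ratEval p q T)) fun x => ?_)
    (hT.norm_ratEval_le p q hq)
  have hr := h.coe_ratEval_restrict_apply p (fun z hz => hq z (hT.spectrum_subset hz)) x
  calc ‖ratEval p q h.restrict x‖ = ‖ratEval p q T x‖ := congrArg norm hr
    _ ≤ ‖ratEval p q T‖ * ‖x‖ := le_opNorm _ _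

end Reducing

/-! ### Reducing subspaces of a restriction -/

section Nested

variable {H : Type u} [NormedAddCommGroup H] [InnerProductSpace ℂ H] [CompleteSpace H]
  {T : H →L[ℂ] H} {L : ClosedSubmodule ℂ H}

theorem IsUnitary.of_linearIsometryEquiv {K : Type u} [NormedAddCommGroup K]
    [InnerProductSpace ℂ K] [CompleteSpace K] {r : ℝ} {S : K →L[ℂ] K} (e : H ≃ₗᵢ[ℂ] K)
    (he : ∀ x, e (T x) = S (e x)) (hT : IsUnitary r T) : IsUnitary r S := by
  have hS : S = e.conjStarAlgEquiv T := by
    ext y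
    rw [LinearIsometryEquiv.conjStarAlgEquiv_apply_apply, he, e.apply_symm_apply]
  subst hS
  obtain ⟨hn, hs⟩ := hT
  refine ⟨⟨?_⟩, ?_⟩
  · rw [← map_star]
    exact hn.star_comm_self.map e.conjStarAlgEquiv
  · rwa [AlgEquiv.spectrum_eq e.conjStarAlgEquiv]

theorem IsIsometry.of_linearIsometryEquiv {K : Type u} [NormedAddCommGroup K]
    [InnerProductSpace ℂ K] [CompleteSpace K] {r : ℝ} {S : K →L[ℂ] K} (e : H ≃ₗᵢ[ℂ] K)
    (he : ∀ x, e (T x) = S (e x)) (hT : IsIsometry r T) : IsIsometry r S := by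
  obtain ⟨hs, K', _, _, _, U, J, hU, hJ⟩ := hT
  have hS : S = e.conjStarAlgEquiv T := by
    ext y
    rw [LinearIsometryEquiv.conjStarAlgEquiv_apply_apply, he, e.apply_symm_apply]
  refine ⟨?_, K', _, _, ‹_›, U, J.comp e.symm.toLinearIsometry, hU, fun x => ?_⟩
  · rwa [hS, AlgEquiv.spectrum_eq e.conjStarAlgEquiv]
  · simp [hS, hJ]

/-- A subspace `N` that reduces `T|_L` is, viewed in the whole space, a subspace that reduces `T`,
and the restriction of `T|_L` to `N` is unitarily equivalent to the restriction of `T`. -/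
theorem Reduces.exists_reduces_of_restrict (h : Reduces L T)
    {N : ClosedSubmodule ℂ L.toSubmodule} (hN : Reduces N h.restrict) :
    ∃ (N' : ClosedSubmodule ℂ H) (hN' : Reduces N' T) (e : N.toSubmodule ≃ₗᵢ[ℂ] N'.toSubmodule),
      N' ≤ L ∧ (∀ x, e (hN.restrict x) = hN'.restrict (e x)) ∧ (N' = ⊥ → N = ⊥) := by
  let N' : ClosedSubmodule ℂ H := ⟨N.toSubmodule.map L.toSubmodule.subtype,
    (L.isClosed.isClosedEmbedding_subtypeVal.isClosedMap N N.isClosed :)⟩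
  have hN' : Reduces N' T :=
    { map_mem := by
        rintro _ ⟨x, hx, rfl⟩
        exact ⟨h.restrict x, hN.map_mem x hx, rfl⟩
      adjoint_map_mem := by
        rintro _ ⟨x, hx, rfl⟩
        exact ⟨adjoint h.restrict x, hN.adjoint_map_mem x hx, h.coe_adjoint_restrict_apply x⟩ }
  let e : N.toSubmodule ≃ₗᵢ[ℂ] N'.toSubmodule :=
    { toLinearEquiv := Submodule.equivMapOfInjective L.toSubmodule.subtype
        L.toSubmodule.injective_subtype N.toSubmodule
      norm_map' := fun x => rfl }
  refine ⟨N', hN', e, ?_, fun x => rfl, fun h0 => ?_⟩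
  · rintro _ ⟨x, -, rfl⟩
    exact x.2
  · refine eq_bot_iff.2 fun x hx => ?_
    have hx' : (x : H) ∈ N' := ⟨x, hx, rfl⟩
    rw [h0] at hx'
    exact Subtype.ext hx'

end Nested

/-! ### The decomposition -/

section Decomposition

variable {H : Type u} [NormedAddCommGroup H] [InnerProductSpace ℂ H] [CompleteSpace H]
  {T : H →L[ℂ] H}

/-- The largest closed subspace that reduces `T` and lies in the kernel of its defect operator. -/
noncomputable def isometricPart (r : ℝ) (T : H →L[ℂ] H) : ClosedSubmodule ℂ H :=
  sSup {L | Reduces L T ∧ ∀ x ∈ L, defect r T x = 0}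

theorem reduces_isometricPart (r : ℝ) (T : H →L[ℂ] H) : Reduces (isometricPart r T) T :=
  reduces_sSup fun _ hL => hL.1

theorem defect_apply_of_mem_isometricPart {r : ℝ} {x : H} (hx : x ∈ isometricPart r T) :
    defect r T x = 0 := by
  have h : isometricPart r T ≤ (⊥ : ClosedSubmodule ℂ H).comap (defect r T) :=
    sSup_le fun L hL y hy => hL.2 y hy
  exact h hx

/-- A contraction restricts to an isometry on exactly those reducing subspaces that lie in its
isometric part. -/
theorem IsContraction.isIsometry_restrict_iff {r : ℝ} (hr0 : 0 < r) (hr1 : r < 1)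
    (hT : IsContraction r T) {L : ClosedSubmodule ℂ H} (h : Reduces L T) :
    IsIsometry r h.restrict ↔ L ≤ isometricPart r T := by
  rw [(hT.restrict h).isIsometry_iff hr0 hr1, h.defect_restrict_eq_zero_iff]
  exact ⟨fun h0 => le_sSup ⟨h, h0⟩, fun hL x hx => defect_apply_of_mem_isometricPart (hL hx)⟩

theorem IsCNUContraction.isPureIsometry_restrict {r : ℝ} (hT : IsCNUContraction r T)
    {L : ClosedSubmodule ℂ H} (h : Reduces L T) (hL : IsIsometry r h.restrict) :
    IsPureIsometry r h.restrict := by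
  refine ⟨hL, fun N hN hU => ?_⟩
  obtain ⟨N', hN', e, -, he, hbot⟩ := h.exists_reduces_of_restrict hN
  exact hbot (hT.eq_bot N' hN' (hU.of_linearIsometryEquiv e he))

/-- The c.n.i. condition on a reducing subspace `L` concerns only one subspace of `L`, its
intersection with the isometric part of `T`. -/
theorem IsContraction.isCNIContraction_restrict_iff {r : ℝ} (hr0 : 0 < r) (hr1 : r < 1)
    (hT : IsContraction r T) {L : ClosedSubmodule ℂ H} (h : Reduces L T) :
    IsCNIContraction r h.restrict ↔ L ⊓ isometricPart r T = ⊥ := by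
  constructor
  · intro hc
    let N : ClosedSubmodule ℂ L.toSubmodule := (isometricPart r T).comap L.toSubmodule.subtypeL
    have hN : Reduces N h.restrict :=
      { map_mem := fun x hx => (reduces_isometricPart r T).map_mem x hx
        adjoint_map_mem := fun x hx => by
          have := (reduces_isometricPart r T).adjoint_map_mem x hx
          rwa [← h.coe_adjoint_restrict_apply] at this }
    have hI : IsIsometry r hN.restrict := by
      rw [((hT.restrict h).restrict hN).isIsometry_iff hr0 hr1, hN.defect_restrict_eq_zero_iff]
      exact fun x hx => Subtype.ext <|
        (h.coe_defect_restrict_apply r x).trans (defect_apply_of_mem_isometricPart hx)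
    refine eq_bot_iff.2 fun x hx => ?_
    have hxN : (⟨x, hx.1⟩ : L.toSubmodule) ∈ N := hx.2
    rw [hc.eq_bot N hN hI] at hxN
    exact congrArg Subtype.val hxN
  · refine fun hL => ⟨hT.restrict h, fun N hN hI => ?_⟩
    obtain ⟨N', hN', e, hle, he, hbot⟩ := h.exists_reduces_of_restrict hN
    refine hbot (le_bot_iff.1 (hL ▸ le_inf hle ?_))
    exact (hT.isIsometry_restrict_iff hr0 hr1 hN').1 (hI.of_linearIsometryEquiv e he)

end Decomposition

end Annulus

theorem mainTheorem5 {H : Type u} [NormedAddCommGroup H] [InnerProductSpace ℂ H] [CompleteSpace H]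
    (r : ℝ) (hr0 : 0 < r) (hr1 : r < 1) (T : H →L[ℂ] H) (hT : Annulus.IsCNUContraction r T) :
    ∃! D : ClosedSubmodule ℂ H × ClosedSubmodule ℂ H,
      D.1.toSubmodule ⟂ D.2.toSubmodule ∧ D.1.toSubmodule ⊔ D.2.toSubmodule = ⊤ ∧
      ∃ (h₁ : Annulus.Reduces D.1 T) (h₂ : Annulus.Reduces D.2 T),
        Annulus.IsPureIsometry r h₁.restrict ∧ Annulus.IsCNIContraction r h₂.restrict := by
  have hc := hT.isContraction
  set M := Annulus.isometricPart r T
  have hMr : Annulus.Reduces M T := Annulus.reduces_isometricPart r T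
  refine ⟨(M, Mᗮ), ⟨Submodule.isOrtho_orthogonal_right _,
    Submodule.sup_orthogonal_of_hasOrthogonalProjection, hMr, hMr.orthogonal,
    hT.isPureIsometry_restrict hMr ((hc.isIsometry_restrict_iff hr0 hr1 hMr).2 le_rfl),
    (hc.isCNIContraction_restrict_iff hr0 hr1 hMr.orthogonal).2 ?_⟩, ?_⟩
  · exact ClosedSubmodule.toSubmodule_injective
      ((inf_comm _ _).trans M.toSubmodule.inf_orthogonal_eq_bot)
  · rintro ⟨D₁, D₂⟩ ⟨hperp, hsup, h₁, h₂, hpure, hcni⟩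
    have hle : D₁ ≤ M := (hc.isIsometry_restrict_iff hr0 hr1 h₁).1 hpure.isIsometry
    have hbot : D₂ ⊓ M = ⊥ := (hc.isCNIContraction_restrict_iff hr0 hr1 h₂).1 hcni
    have hD₁ : D₁ = M := by
      refine le_antisymm hle fun x hx => ?_
      obtain ⟨a, ha, b, hb, rfl⟩ := Submodule.mem_sup.1 (hsup.ge (Submodule.mem_top (x := x)))
      -- as `D₁ ≤ M`, the component of `x` in `D₂` also lies in `M`
      have hbM : b ∈ D₂ ⊓ M := ⟨hb, by simpa using M.toSubmodule.sub_mem hx (hle ha)⟩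
      rw [hbot, ClosedSubmodule.mem_bot] at hbM
      rwa [hbM, add_zero]
    have hD₂ : D₂ = Mᗮ := by
      refine le_antisymm (hD₁ ▸ hperp.ge) fun x hx => ?_
      obtain ⟨a, ha, b, hb, rfl⟩ := Submodule.mem_sup.1 (hsup.ge (Submodule.mem_top (x := x)))
      -- the component of `x` in `D₁` lies in `M`, hence is orthogonal to `x` and to itself
      have ha0 : inner ℂ a a = 0 := by
        have h := hx a (hle ha)
        rwa [inner_add_right, hperp.inner_eq ha hb, add_zero] at h
      rw [inner_self_eq_zero.1 ha0, zero_add]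
      exact hb
    rw [hD₁, hD₂]
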